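/- A Stirling permutation of order $n$ is a permutation $\sigma=\sigma_1\sigma_2\cdots\sigma_{2n}$ of the multiset $\{1,1,2,2,\ldots,n,n\}$ such that, for each $i\in\{1,\ldots,n\}$, every element between the two occurrences of $i$ is greater than $i$. Let $\mathcal{Q}_n(123)$ be the set of Stirling permutations of order $n$ that avoid the pattern $123$, that is, for which there are no positions $i_1<i_2<i_3$ with $\sigma_{i_1}<\sigma_{i_2}<\sigma_{i_3}$. Let $\mathrm{plat}(\sigma)$, $\mathrm{des}(\sigma)$ and $\mathrm{asc}(\sigma)$ be the numbers of indices $1\le i\le 2n-1$ with $\sigma_i=\sigma_{i+1}$, $\sigma_i>\sigma_{i+1}$ and $\sigma_i<\sigma_{i+1}$, respectively, and put $$C_{n,123}(p,q,r)=\sum_{\sigma\in\mathcal{Q}_n(123)}p^{\mathrm{plat}(\sigma)}q^{\mathrm{des}(\sigma)}r^{\mathrm{asc}(\sigma)}.$$ For every $n\ge 1$, the polynomial $q\,C_{n,123}(p,q,r)$ is symmetric in $p$ and $q$. Furthermore, $$\sum_{\sigma\in\mathcal{Q}_n(123)}p^{\mathrm{plat}(\sigma)}=\frac{1}{n+1}\sum_{j=0}^{n}\binom{n+1}{j}\binom{2n-j}{n+j}p^{n-j}.$$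 -/

import Mathlib

/-- The multiset `{1, 1, 2, 2, …, n, n}`. -/
def doubledMultiset (n : ℕ) : Multiset ℕ := 2 • (Finset.Icc 1 n).val

/-- A word `w` is a Stirling permutation of order `n` if it is a rearrangement of
`{1, 1, 2, 2, …, n, n}` such that every letter standing between the two occurrences of a letter
`a` is greater than `a`. -/
def IsStirlingPerm (n : ℕ) (w : List ℕ) : Prop :=
  (w : Multiset ℕ) = doubledMultiset n ∧ ∀ a b : ℕ, [a, b, a].Sublist w → a < b

/-- The word `w` contains the pattern `τ` if it has a (not necessarily contiguous) subsequence
whose letters are in the same relative order as those of `τ`. -/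
def ContainsPattern (τ w : List ℕ) : Prop :=
  ∃ s : List ℕ, s.Sublist w ∧ ∃ h : s.length = τ.length,
    ∀ i j : Fin τ.length, τ.get i < τ.get j ↔ s.get (i.cast h.symm) < s.get (j.cast h.symm)

open Classical in
/-- The finite set of Stirling permutations of order `n` that avoid the pattern `τ`. -/
noncomputable def avoidingStirlingPerms (n : ℕ) (τ : List ℕ) : Finset (List ℕ) :=
  (doubledMultiset n).lists.toFinset.filter fun w => IsStirlingPerm n w ∧ ¬ ContainsPattern τ w

theorem mem_avoidingStirlingPerms (n : ℕ) (τ w : List ℕ) :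
    w ∈ avoidingStirlingPerms n τ ↔ IsStirlingPerm n w ∧ ¬ ContainsPattern τ w := by
  classical
  unfold avoidingStirlingPerms
  rw [Finset.mem_filter, Multiset.mem_toFinset, Multiset.mem_lists_iff]
  exact ⟨fun h => h.2, fun h => ⟨h.1.1.symm, h⟩⟩

/-- The number of plateaus: positions `i` with `w_i = w_{i+1}`. -/
def plat (w : List ℕ) : ℕ := (w.zip w.tail).countP fun x => x.1 = x.2

/-- The number of descents: positions `i` with `w_i > w_{i+1}`. -/
def des (w : List ℕ) : ℕ := (w.zip w.tail).countP fun x => x.1 > x.2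

/-- The number of ascents: positions `i` with `w_i < w_{i+1}`. -/
def asc (w : List ℕ) : ℕ := (w.zip w.tail).countP fun x => x.1 < x.2

/-- The polynomial `C_{n,τ}(p, q, r) = ∑ p ^ plat σ * q ^ des σ * r ^ asc σ` over the Stirling
permutations `σ` of order `n` that avoid `τ`; the variables `p, q, r` are `X 0, X 1, X 2`. -/
noncomputable def stirlingPoly (n : ℕ) (τ : List ℕ) : MvPolynomial (Fin 3) ℚ :=
  ∑ σ ∈ avoidingStirlingPerms n τ,
    MvPolynomial.X 0 ^ plat σ * MvPolynomial.X 1 ^ des σ * MvPolynomial.X 2 ^ asc σ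

/-!
Deleting the two copies of the largest letter `N` from a `123`-avoiding Stirling permutation leaves
a smaller one, and the two copies were adjacent. Conversely `N N` may be inserted exactly after a
weakly decreasing prefix: an ascent to its left would complete a `123`. End every word with a
sentinel `0`, so that the last letter contributes one more descent; this is the factor `q` of
`q * C_n`. Insertion in front of the word adds a plateau and a descent there, and an insertion
elsewhere replaces a single step by ascent, plateau, descent.

Under these rules the steps inside the initial weakly decreasing run alternate: plateau, descent,
plateau, descent, and so on. Hence the future of a word depends only on the number `l` of
alternating steps and on whether they are followed by an ascent (`ascState`) or exhaust the
word (`endState`). This gives linear recurrences for the weighted numbers of descendants, and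
`q * C_n` is `endState p q r n 0`, the sum over all descendants of the empty word
(`sum_plat_des_asc`).

The recurrences are solved by products. If the power series `U` satisfies
`U = 1 + X p q U (1 + (1 + X r q U) (1 + X r p U))`, then the generating function of `ascState` at
`l` is `U` times the product of the first `l` factors of the alternating sequence `1 + X r q U`,
`1 + X r p U`, `1 + X r q U`, …, and that of `endState` at `j` is the `j`-th power of
`(1 + X r q U) (1 + X r p U)` times a series `T` with
`T = 1 + X p q (1 + X r q U) (1 + X r p U) T` (`coeff_mul_prod_eq_ascState`, `coeff_eq_endState`).
The equations for `U` and `T` are symmetric in `p` and `q`, and therefore so is `q * C_n`.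

For `q = r = 1` the series `F = X p T` satisfies `F (1 - F)² = X (p (1 - F) + F²)`, that is
`F = X φ(F)` with `φ = p / (1 - X) + X² / (1 - X)²`. Lagrange inversion (`lagrange_inversion`) and
the binomial theorem then give the coefficients of `T`.
-/

/-! ### Fixed points of contractions on power series -/

section Series

open PowerSeries

/-- A map of power series that is contracting for the `X`-adic metric has a fixed point, the limit
of the iterates at `0`. -/
theorem exists_powerSeries_fixedPoint {R : Type*} [CommRing R] (Φ : R⟦X⟧ → R⟦X⟧)
    (hΦ : ∀ n f g, (X : R⟦X⟧) ^ n ∣ f - g → (X : R⟦X⟧) ^ (n + 1) ∣ Φ f - Φ g) :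
    ∃ f, f = Φ f := by
  have step : ∀ n, (X : R⟦X⟧) ^ n ∣ Φ^[n + 1] 0 - Φ^[n] 0 := by
    intro n
    induction n with
    | zero => simp
    | succ n ih =>
      have := hΦ _ _ _ ih
      rwa [← Function.iterate_succ_apply' Φ, ← Function.iterate_succ_apply' Φ] at this
  -- The first `n` coefficients are stationary from the `n`-th iterate on.
  have far : ∀ n k, (X : R⟦X⟧) ^ n ∣ Φ^[n + k] 0 - Φ^[n] 0 := by
    intro n k
    induction k with
    | zero => simp
    | succ k ih =>
      have := ((pow_dvd_pow (X : R⟦X⟧) (Nat.le_add_right n k)).trans (step (n + k))).add ih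
      simpa [← add_assoc] using this
  let f : R⟦X⟧ := mk fun n => coeff n (Φ^[n + 1] 0)
  have hf : ∀ n, (X : R⟦X⟧) ^ n ∣ f - Φ^[n] 0 := by
    intro n
    rw [X_pow_dvd_iff]
    intro m hm
    obtain ⟨k, rfl⟩ := Nat.exists_eq_add_of_le (Nat.succ_le_of_lt hm)
    have := X_pow_dvd_iff.1 (far (m + 1) k) m (Nat.lt_succ_self m)
    rw [map_sub, sub_eq_zero] at this
    simp [f, this]
  refine ⟨f, PowerSeries.ext fun n => ?_⟩
  have h1 := X_pow_dvd_iff.1 (hf (n + 1)) n (Nat.lt_succ_self n)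
  have h2 := X_pow_dvd_iff.1 (hΦ n _ _ (hf n)) n (Nat.lt_succ_self n)
  rw [map_sub, sub_eq_zero] at h1 h2
  rw [h1, h2, Function.iterate_succ_apply']

variable {R : Type*} [CommRing R]

/-! ### The recurrences for the numbers of descendants -/

/-- In an alternating run, step `i` is a plateau for even `i` and a descent for odd `i`. Inserting
a doubled letter into it multiplies the weight by `r * cutWeight p q i`, which is `p * q * r`
divided by the weight of that step. -/
def cutWeight (p q : R) (i : ℕ) : R := if Even i then q else p

/-- `ascState p q r m l` is the weighted number of ways to make `m` successive insertions into a word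
that starts with `l` alternating steps followed by an ascent, relative to the weight of that
word. The three terms are insertion in front, into the ascent, and into step `i` of the run. -/
def ascState (p q r : R) : ℕ → ℕ → R
  | 0, _ => 1
  | m + 1, l => p * q * ascState p q r m (l + 2) + p * q * ascState p q r m l +
      r * ∑ i ∈ Finset.range l, cutWeight p q i * ascState p q r m i

/-- `endState p q r m j` is the weighted number of ways to make `m` successive insertions into a word
of length `2 * j` all of whose steps alternate, the descent to the sentinel `0` included, relative
to the weight of that word. -/
def endState (p q r : R) : ℕ → ℕ → R
  | 0, _ => 1
  | m + 1, j => p * q * endState p q r m (j + 1) +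
      r * ∑ i ∈ Finset.range (2 * j), cutWeight p q i * ascState p q r m i

/-- The equation of the generating function of `ascState p q r m 0` in `m`. -/
def IsStateSeries (p q r : R) (U : R⟦X⟧) : Prop :=
  U = 1 + X * (C (p * q) * (U * (1 + (1 + X * (C (r * q) * U)) * (1 + X * (C (r * p) * U)))))

theorem IsStateSeries.swap {p q r : R} {U : R⟦X⟧} (hU : IsStateSeries p q r U) :
    IsStateSeries q p r U := by
  unfold IsStateSeries at *
  rw [mul_comm q p, mul_comm (1 + X * (C (r * p) * U))]
  exact hU

theorem exists_isStateSeries (p q r : R) : ∃ U, IsStateSeries p q r U := by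
  apply exists_powerSeries_fixedPoint (fun U : R⟦X⟧ =>
    1 + X * (C (p * q) * (U * (1 + (1 + X * (C (r * q) * U)) * (1 + X * (C (r * p) * U))))))
  intro n f g hfg
  rw [add_sub_add_left_eq_sub, ← mul_sub, pow_succ']
  refine mul_dvd_mul_left _ ?_
  rw [← mul_sub]
  refine Dvd.dvd.mul_left (hfg.trans ⟨1 + 1 + X * (C (r * q) + C (r * p)) * (f + g) +
    X ^ 2 * C (r * q) * C (r * p) * (f ^ 2 + f * g + g ^ 2), by ring⟩) _

theorem exists_eq_one_add_X_mul (A : R⟦X⟧) : ∃ T : R⟦X⟧, T = 1 + X * (A * T) := by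
  apply exists_powerSeries_fixedPoint (fun T : R⟦X⟧ => 1 + X * (A * T))
  intro n f g hfg
  rw [add_sub_add_left_eq_sub, ← mul_sub, ← mul_sub, pow_succ']
  exact mul_dvd_mul_left _ (hfg.mul_left _)

/-- Two consecutive steps are one plateau and one descent, in either order. -/
theorem prod_range_add_two (p q r : R) (U : R⟦X⟧) (l : ℕ) :
    ∏ i ∈ Finset.range (l + 2), (1 + X * (C (r * cutWeight p q i) * U)) =
      (∏ i ∈ Finset.range l, (1 + X * (C (r * cutWeight p q i) * U))) *
        ((1 + X * (C (r * q) * U)) * (1 + X * (C (r * p) * U))) := by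
  rw [Finset.prod_range_succ, Finset.prod_range_succ, mul_assoc]
  congr 1
  rcases Nat.even_or_odd l with h | h
  · have h' : ¬ Even (l + 1) := by simpa [Nat.even_add_one] using h
    simp [cutWeight, h, h']
  · have h' : ¬ Even l := by simpa using h
    have h'' : Even (l + 1) := h.add_one
    simp [cutWeight, h', h'', mul_comm]

/-- Telescoping: expand the product at its last nontrivial factor. -/
theorem prod_range_eq_one_add_sum (p q r : R) (U : R⟦X⟧) (l : ℕ) :
    ∏ i ∈ Finset.range l, (1 + X * (C (r * cutWeight p q i) * U)) =
      1 + X * (C r * ∑ i ∈ Finset.range l, C (cutWeight p q i) *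
        (U * ∏ j ∈ Finset.range i, (1 + X * (C (r * cutWeight p q j) * U)))) := by
  induction l with
  | zero => simp
  | succ l ih =>
    rw [Finset.prod_range_succ, Finset.sum_range_succ, mul_add, mul_add, mul_add, ← add_assoc, ← ih]
    simp only [map_mul]
    ring

/-- The products `U * ∏ i < l, (1 + X r cᵢ U)` satisfy the linear system that defines `ascState`, and
that system determines its solution. -/
theorem coeff_mul_prod_eq_ascState {p q r : R} {U : R⟦X⟧} (hU : IsStateSeries p q r U) (m l : ℕ) :
    coeff m (U * ∏ i ∈ Finset.range l, (1 + X * (C (r * cutWeight p q i) * U))) =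
      ascState p q r m l := by
  have key : ∀ l, U * ∏ i ∈ Finset.range l, (1 + X * (C (r * cutWeight p q i) * U)) =
      1 + X * (C (p * q) *
          (U * ∏ i ∈ Finset.range (l + 2), (1 + X * (C (r * cutWeight p q i) * U))) +
        C (p * q) * (U * ∏ i ∈ Finset.range l, (1 + X * (C (r * cutWeight p q i) * U))) +
        C r * ∑ i ∈ Finset.range l, C (cutWeight p q i) *
          (U * ∏ j ∈ Finset.range i, (1 + X * (C (r * cutWeight p q j) * U)))) := by
    intro l
    have h := prod_range_eq_one_add_sum p q r U l
    rw [prod_range_add_two]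
    set P := ∏ i ∈ Finset.range l, (1 + X * (C (r * cutWeight p q i) * U))
    unfold IsStateSeries at hU
    linear_combination P * hU + h
  induction m generalizing l with
  | zero => rw [key]; simp [ascState]
  | succ m ih =>
    rw [key, ascState, map_add, coeff_succ_X_mul]
    simp only [map_add, coeff_C_mul, map_sum, ih]
    simp [coeff_one]

theorem coeff_eq_endState {p q r : R} {U T : R⟦X⟧} (hU : IsStateSeries p q r U)
    (hT : T = 1 + X *
      (C (p * q) * ((1 + X * (C (r * q) * U)) * (1 + X * (C (r * p) * U))) * T)) (m j : ℕ) :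
    coeff m ((∏ i ∈ Finset.range (2 * j), (1 + X * (C (r * cutWeight p q i) * U))) * T) =
      endState p q r m j := by
  have key : ∀ j, (∏ i ∈ Finset.range (2 * j), (1 + X * (C (r * cutWeight p q i) * U))) * T =
      1 + X * (C (p * q) *
          ((∏ i ∈ Finset.range (2 * (j + 1)), (1 + X * (C (r * cutWeight p q i) * U))) * T) +
        C r * ∑ i ∈ Finset.range (2 * j), C (cutWeight p q i) *
          (U * ∏ j ∈ Finset.range i, (1 + X * (C (r * cutWeight p q j) * U)))) := by
    intro j
    have h := prod_range_eq_one_add_sum p q r U (2 * j)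
    rw [mul_add 2 j 1, mul_one, prod_range_add_two]
    set P := ∏ i ∈ Finset.range (2 * j), (1 + X * (C (r * cutWeight p q i) * U))
    linear_combination P * hT + h
  induction m generalizing j with
  | zero => rw [key]; simp [endState]
  | succ m ih =>
    rw [key, endState, map_add, coeff_succ_X_mul]
    simp only [map_add, coeff_C_mul, map_sum, ih, coeff_mul_prod_eq_ascState hU]
    simp [coeff_one]

/-- The same series `U` and `T` serve `(p, q)` and `(q, p)`. -/
theorem endState_zero_swap (p q r : R) (n : ℕ) :
    endState q p r n 0 = endState p q r n 0 := by
  obtain ⟨U, hU⟩ := exists_isStateSeries p q r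
  obtain ⟨T, hT⟩ := exists_eq_one_add_X_mul
    (C (p * q) * ((1 + X * (C (r * q) * U)) * (1 + X * (C (r * p) * U))))
  rw [← coeff_eq_endState hU hT, ← coeff_eq_endState hU.swap (T := T)]
  · simp
  · rw [mul_comm q p, mul_comm (1 + X * (C (r * p) * U))]
    exact hT

end Series

/-! ### Lagrange inversion -/

section Lagrange

open PowerSeries

variable {R : Type*} [CommRing R]

theorem coeff_subst_eq_sum {F : R⟦X⟧} (hF : (X : R⟦X⟧) ∣ F) (f : R⟦X⟧) (m : ℕ) :
    coeff m (f.subst F) = ∑ j ∈ Finset.range (m + 1), coeff j f * coeff m (F ^ j) := by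
  have hs : HasSubst F := HasSubst.of_constantCoeff_zero' (X_dvd_iff.1 hF)
  rw [coeff_subst' hs, finsum_eq_sum_of_support_subset (s := Finset.range (m + 1))]
  · simp
  · intro j hj
    by_contra hjm
    simp only [Finset.coe_range, Set.mem_Iio, not_lt] at hjm
    apply hj
    simp [X_pow_dvd_iff.1 (pow_dvd_pow_of_dvd hF j) m hjm]

theorem coeff_X_mul_derivative (f : R⟦X⟧) (m : ℕ) :
    coeff m (X * derivative R f) = m * coeff m f := by
  cases m with
  | zero => simp
  | succ m => rw [coeff_succ_X_mul, coeff_derivative]; push_cast; ring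

/-- **Lagrange inversion**: if `F = X φ(F)` then `n [Xⁿ] Fᵏ = k [Xⁿ⁻ᵏ] φⁿ`, here with `n = k + m`.
The constant coefficient of `φ` need not be a unit. The proof is by induction on `m`, comparing
coefficients in `Fᵏ = Xᵏ φᵏ(F)`. -/
theorem lagrange_inversion [IsDomain R] [CharZero R] {F φ : R⟦X⟧} (hX : (X : R⟦X⟧) ∣ F)
    (hF : F = X * φ.subst F) (k m : ℕ) :
    ((k + m : ℕ) : R) * coeff (k + m) (F ^ k) = k * coeff m (φ ^ (k + m)) := by
  have hs : HasSubst F := HasSubst.of_constantCoeff_zero' (X_dvd_iff.1 hX)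
  have expand : ∀ k m, coeff (k + m) (F ^ k) =
      ∑ j ∈ Finset.range (m + 1), coeff j (φ ^ k) * coeff m (F ^ j) := by
    intro k m
    rw [← coeff_subst_eq_sum hX, subst_pow hs, hF, mul_pow, ← hF, add_comm k m, coeff_X_pow_mul]
  induction m using Nat.strong_induction_on generalizing k with
  | _ m ih =>
    rcases Nat.eq_zero_or_pos m with rfl | hm
    · rw [expand]; simp
    have hm0 : (m : R) ≠ 0 := by exact_mod_cast hm.ne'
    apply mul_left_cancel₀ hm0
    have h1 : (m : R) * coeff (k + m) (F ^ k) =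
        coeff m (X * derivative R (φ ^ k) * φ ^ m) := by
      rw [expand, coeff_mul, Finset.Nat.sum_antidiagonal_eq_sum_range_succ_mk, Finset.mul_sum]
      refine Finset.sum_congr rfl fun j hj => ?_
      have hjm : j ≤ m := Nat.lt_succ_iff.1 (Finset.mem_range.1 hj)
      rw [coeff_X_mul_derivative]
      rcases j with _ | j
      · simp [coeff_one, hm.ne']
      · have := ih (m - (j + 1)) (by omega) (j + 1)
        rw [Nat.add_sub_cancel' hjm] at this
        rw [mul_left_comm, this]
        ring
    have h2 : ((k + m : ℕ) : R⟦X⟧) * (X * derivative R (φ ^ k) * φ ^ m) =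
        (k : R⟦X⟧) * (X * derivative R (φ ^ (k + m))) := by
      rw [derivative_pow, derivative_pow]
      rcases k with _ | k
      · simp
      rw [show k + 1 + m - 1 = k + m by omega, Nat.add_sub_cancel]
      ring
    have h3 := congrArg (coeff m) h2
    rw [← map_natCast (C : R →+* R⟦X⟧), ← map_natCast (C : R →+* R⟦X⟧), coeff_C_mul,
      coeff_C_mul, ← h1, coeff_X_mul_derivative] at h3
    linear_combination h3

end Lagrange

/-! ### The coefficients for `q = r = 1` -/

section PlateauFormula

open PowerSeries

variable {R : Type*} [CommRing R]

/-- The coefficient of `Xⁿ` in `(p / (1 - X) + X² / (1 - X)²) ^ (n + 1)`. -/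
theorem coeff_add_pow_eq_sum (p : R) (n : ℕ) :
    coeff n ((C p * mk 1 + X ^ 2 * mk 1 ^ 2 : R⟦X⟧) ^ (n + 1)) =
      p * ∑ j ∈ Finset.range (n + 1),
        (((n + 1).choose j : R) * ((2 * n - j).choose (n + j) : R)) * p ^ (n - j) := by
  have term : ∀ j, coeff n ((X ^ 2 * mk 1 ^ 2 : R⟦X⟧) ^ j * (C p * mk 1) ^ (n + 1 - j) *
      ((n + 1).choose j : R⟦X⟧)) =
      ((n + 1).choose j : R) * ((2 * n - j).choose (n + j) : R) * p ^ (n + 1 - j) := by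
    intro j
    -- For `j > n` the truncated subtraction is harmless: one of the binomials vanishes.
    rcases le_or_gt (n + 1) j with hj | hj
    · rcases hj.eq_or_lt with rfl | hj
      · rw [mul_pow, ← pow_mul, mul_assoc, mul_assoc, coeff_X_pow_mul', if_neg (by omega),
          Nat.choose_eq_zero_of_lt (show 2 * n - (n + 1) < n + (n + 1) by omega)]
        simp
      · rw [Nat.choose_eq_zero_of_lt hj]; simp
    have e : (X ^ 2 * mk 1 ^ 2 : R⟦X⟧) ^ j * (C p * mk 1) ^ (n + 1 - j) *
        ((n + 1).choose j : R⟦X⟧) =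
        C (((n + 1).choose j : R) * p ^ (n + 1 - j)) * (X ^ (2 * j) * mk 1 ^ (n + j + 1)) := by
      rw [show n + j + 1 = 2 * j + (n + 1 - j) by omega, pow_add, map_mul, map_pow, map_natCast]
      ring
    rw [e, coeff_C_mul, coeff_X_pow_mul', mk_one_pow_eq_mk_choose_add]
    split_ifs with h
    · rw [coeff_mk, show n + j + (n - 2 * j) = 2 * n - j by omega]
      ring
    · rw [Nat.choose_eq_zero_of_lt (show 2 * n - j < n + j by omega)]
      simp
  rw [add_comm (C p * mk 1 : R⟦X⟧), add_pow, map_sum, Finset.sum_congr rfl fun j _ => term j,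
    Finset.sum_range_succ,
    Nat.choose_eq_zero_of_lt (show 2 * n - (n + 1) < n + (n + 1) by omega), Finset.mul_sum]
  simp only [Nat.cast_zero, mul_zero, zero_mul, add_zero]
  refine Finset.sum_congr rfl fun j hj => ?_
  rw [Finset.mem_range] at hj
  rw [show n + 1 - j = n - j + 1 by omega, pow_succ]
  ring

theorem succ_mul_endState_one_one [IsDomain R] [CharZero R] {p : R} (hp : p ≠ 0) (n : ℕ) :
    ((n + 1 : ℕ) : R) * endState p 1 1 n 0 = ∑ j ∈ Finset.range (n + 1),
      (((n + 1).choose j : R) * ((2 * n - j).choose (n + j) : R)) * p ^ (n - j) := by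
  obtain ⟨U, hU⟩ := exists_isStateSeries p 1 1
  obtain ⟨T, hT⟩ := exists_eq_one_add_X_mul
    (C (p * 1) * ((1 + X * (C (1 * 1) * U)) * (1 + X * (C (1 * p) * U))))
  have hcoeff := coeff_eq_endState hU hT n 0
  simp only [mul_zero, Finset.range_zero, Finset.prod_empty, one_mul] at hcoeff
  unfold IsStateSeries at hU
  simp only [mul_one, one_mul, map_one] at hU hT
  set F : R⟦X⟧ := X * (C p * T) with hFdef
  have hFX : (X : R⟦X⟧) ∣ F := ⟨_, rfl⟩
  have hs : HasSubst F := HasSubst.of_constantCoeff_zero' (X_dvd_iff.1 hFX)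
  -- The two fixed-point equations say `U⁻¹ - T⁻¹ = -p X`.
  have hUT : U * (1 - F) = T := by
    rw [hFdef]
    linear_combination T * hU - U * hT
  have hcubic : F * (1 - F) ^ 2 = X * (C p * (1 - F) + F ^ 2) := by
    have hA : (1 - F) * (1 + X * U) = 1 - F + X * T := by linear_combination X * hUT
    have hB : (1 - F) * (1 + X * (C p * U)) = 1 := by
      linear_combination X * C p * hUT - hFdef
    have hAB : ((1 - F) * (1 + X * U)) * ((1 - F) * (1 + X * (C p * U))) = 1 - F + X * T := by
      rw [hA, hB, mul_one]
    linear_combination X * C p * (1 - F) ^ 2 * hT + X * C p * (X * C p * T) * hAB +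
      ((1 - F) ^ 2 - X * C p * (1 - F) - X * (F + X * (C p * T))) * hFdef
  set J : R⟦X⟧ := (mk 1 : R⟦X⟧).subst F with hJ
  have hJ1 : J * (1 - F) = 1 := by
    have := congrArg (substAlgHom hs) (mk_one_mul_one_sub_eq_one R)
    rw [map_mul, map_sub, map_one, coe_substAlgHom, subst_X hs] at this
    exact this
  have hF : F = X * (C p * mk 1 + X ^ 2 * mk 1 ^ 2 : R⟦X⟧).subst F := by
    have : (C p * mk 1 + X ^ 2 * mk 1 ^ 2 : R⟦X⟧).subst F = C p * J + F ^ 2 * J ^ 2 := by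
      rw [subst_add hs, subst_mul hs, subst_mul hs, subst_pow hs, subst_pow hs, subst_X hs,
        subst_C]
      rfl
    rw [this]
    linear_combination J ^ 2 * hcubic + (X * C p * J - F * (1 + J * (1 - F))) * hJ1
  have key := lagrange_inversion hFX hF 1 n
  rw [add_comm 1 n, coeff_add_pow_eq_sum, pow_one, hFdef, coeff_succ_X_mul, coeff_C_mul,
    hcoeff] at key
  apply mul_left_cancel₀ hp
  simpa [mul_left_comm] using key

end PlateauFormula

/-! ### Weights of words and insertion of a doubled letter -/

section Words

variable {R : Type*}

/-- The weight of a step from the letter `a` to the letter `b`: `p` for a plateau, `q` for a descent,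
`r` for an ascent. -/
def stepWeight (p q r : R) (a b : ℕ) : R := if a = b then p else if b < a then q else r

theorem stepWeight_self (p q r : R) (a : ℕ) : stepWeight p q r a a = p := if_pos rfl

theorem stepWeight_of_gt (p q r : R) {a b : ℕ} (h : b < a) : stepWeight p q r a b = q := by
  rw [stepWeight, if_neg h.ne', if_pos h]

theorem stepWeight_of_lt (p q r : R) {a b : ℕ} (h : a < b) : stepWeight p q r a b = r := by
  rw [stepWeight, if_neg h.ne, if_neg h.not_gt]

variable [CommRing R]

/-- The product of the weights of all steps of a word, including the step from its last letter to a
sentinel `0`. -/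
def wordWeight (p q r : R) : List ℕ → R
  | [] => 1
  | a :: l => stepWeight p q r a (l.headD 0) * wordWeight p q r l

/-- Insert `N N` into `w` after the first `i` letters. -/
def insertTwice (N : ℕ) (w : List ℕ) (i : ℕ) : List ℕ := w.take i ++ N :: N :: w.drop i

/-- The positions in `w` with only a weakly decreasing prefix to their left. -/
def insertionSites (w : List ℕ) : Finset ℕ :=
  (Finset.range (w.length + 1)).filter fun i => (w.take i).Pairwise (· ≥ ·)

/-- The total weight of the words obtained from a word `w` with letters at most `n` by `m` successive
insertions of `n + 1`, …, `n + m`, each doubled and put at an insertion site. -/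
def descendantSum (p q r : R) : ℕ → ℕ → List ℕ → R
  | 0, _, w => wordWeight p q r w
  | m + 1, n, w =>
    ∑ i ∈ insertionSites w, descendantSum p q r m (n + 1) (insertTwice (n + 1) w i)

/-- The first `l` steps of `w` are plateau, descent, plateau, descent, …. Letters beyond the end of
`w` are read as the sentinel `0`. -/
def AlternatesUpTo (l : ℕ) (w : List ℕ) : Prop :=
  ∀ i < l, if Even i then w.getD i 0 = w.getD (i + 1) 0 else w.getD (i + 1) 0 < w.getD i 0

theorem getD_lt_of_forall_mem_lt {N : ℕ} (hN : 0 < N) {w : List ℕ} (hw : ∀ a ∈ w, a < N) (i : ℕ) :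
    w.getD i 0 < N := by
  rcases lt_or_ge i w.length with h | h
  · rw [List.getD_eq_getElem _ _ h]; exact hw _ (List.getElem_mem h)
  · rw [List.getD_eq_default _ _ h]; exact hN

theorem AlternatesUpTo.antitone {l : ℕ} {w : List ℕ} (h : AlternatesUpTo l w) {i j : ℕ}
    (hij : i ≤ j) (hj : j ≤ l) : w.getD j 0 ≤ w.getD i 0 := by
  induction j, hij using Nat.le_induction with
  | base => exact le_rfl
  | succ j hij ih =>
    have := h j (by omega)
    have ih := ih (by omega)
    split_ifs at this <;> omega

theorem AlternatesUpTo.pairwise_take {l : ℕ} {w : List ℕ} (h : AlternatesUpTo l w) {i : ℕ}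
    (hi : i ≤ l + 1) : (w.take i).Pairwise (· ≥ ·) := by
  rw [List.pairwise_iff_getElem]
  intro a b ha hb hab
  rw [List.length_take] at ha hb
  have := h.antitone hab.le (by omega)
  rw [List.getD_eq_getElem _ _ (by omega), List.getD_eq_getElem _ _ (by omega)] at this
  simpa using this

theorem AlternatesUpTo.insertionSites_eq_range {w : List ℕ} (h : AlternatesUpTo w.length w) :
    insertionSites w = Finset.range (w.length + 1) := by
  rw [insertionSites, Finset.filter_true_of_mem]
  intro i hi
  exact h.pairwise_take (by simpa using (Finset.mem_range.1 hi).le)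

theorem AlternatesUpTo.insertionSites_eq_range_of_lt {l : ℕ} {w : List ℕ} (h : AlternatesUpTo l w)
    (hl : l + 1 < w.length) (hasc : w.getD l 0 < w.getD (l + 1) 0) :
    insertionSites w = Finset.range (l + 2) := by
  ext i
  simp only [insertionSites, Finset.mem_filter, Finset.mem_range]
  constructor
  · rintro ⟨hi, hp⟩
    by_contra! hli
    rw [List.pairwise_iff_getElem] at hp
    have := hp l (l + 1) (by rw [List.length_take]; omega) (by rw [List.length_take]; omega)
      (Nat.lt_succ_self l)
    rw [List.getD_eq_getElem _ _ (by omega), List.getD_eq_getElem _ _ hl] at hasc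
    simp only [List.getElem_take] at this
    omega
  · intro hi
    exact ⟨by omega, h.pairwise_take (by omega)⟩

/-- The weight of the steps up to the letter `a` does not depend on what follows `a`. -/
theorem exists_wordWeight_append (p q r : R) (u : List ℕ) (a : ℕ) :
    ∃ K, ∀ v, wordWeight p q r (u ++ a :: v) = K * wordWeight p q r (a :: v) := by
  induction u with
  | nil => exact ⟨1, by simp⟩
  | cons b u ih =>
    obtain ⟨K, hK⟩ := ih
    refine ⟨stepWeight p q r b ((u ++ [a]).headD 0) * K, fun v => ?_⟩
    rw [List.cons_append, wordWeight, hK]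
    cases u <;> simp [mul_assoc]

theorem headD_drop (w : List ℕ) (i : ℕ) : (w.drop i).headD 0 = w.getD i 0 := by
  simp [List.headD_eq_head?_getD, List.head?_drop]

theorem wordWeight_insertTwice_zero (p q r : R) {N : ℕ} (hN : 0 < N) {w : List ℕ}
    (hw : ∀ a ∈ w, a < N) :
    wordWeight p q r (insertTwice N w 0) = p * q * wordWeight p q r w := by
  have := getD_lt_of_forall_mem_lt hN hw 0
  rw [← headD_drop, List.drop_zero] at this
  simp only [insertTwice, wordWeight, List.take_zero, List.nil_append, List.drop_zero,
    List.headD_cons, stepWeight_self, stepWeight_of_gt p q r this, mul_assoc]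

/-- Insertion inside a word replaces one step by ascent, plateau, descent. The common factor `K` is the
weight of all other steps; stating it this way avoids division by a step weight. -/
theorem exists_wordWeight_insertTwice_succ (p q r : R) {N : ℕ} {w : List ℕ}
    (hw : ∀ a ∈ w, a < N) {i : ℕ} (hi : i < w.length) :
    ∃ K, wordWeight p q r w = stepWeight p q r (w.getD i 0) (w.getD (i + 1) 0) * K ∧
      wordWeight p q r (insertTwice N w (i + 1)) = r * p * q * K := by
  have hiN : w[i] < N := hw _ (List.getElem_mem hi)
  obtain ⟨K, hK⟩ := exists_wordWeight_append p q r (w.take i) w[i]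
  have e1 : w.take i ++ w[i] :: w.drop (i + 1) = w := by simp
  have e2 : w.take i ++ w[i] :: N :: N :: w.drop (i + 1) = insertTwice N w (i + 1) := by
    rw [insertTwice, List.take_succ_eq_append_getElem hi, List.append_assoc]
    rfl
  refine ⟨K * wordWeight p q r (w.drop (i + 1)), ?_, ?_⟩
  · rw [← e1, hK, e1, wordWeight, headD_drop, List.getD_eq_getElem _ _ hi]
    ring
  · have h1 := getD_lt_of_forall_mem_lt (by omega) hw (i + 1)
    rw [← e2, hK]
    simp only [wordWeight, headD_drop, List.headD_cons, stepWeight_self,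
      stepWeight_of_gt p q r h1, stepWeight_of_lt p q r hiN]
    ring

theorem AlternatesUpTo.wordWeight_insertTwice (p q r : R) {N l : ℕ} {w : List ℕ}
    (h : AlternatesUpTo l w) (hw : ∀ a ∈ w, a < N) {i : ℕ} (hi : i < l) (hlen : i < w.length) :
    wordWeight p q r (insertTwice N w (i + 1)) =
      r * cutWeight p q i * wordWeight p q r w := by
  obtain ⟨K, h1, h2⟩ := exists_wordWeight_insertTwice_succ p q r hw hlen
  have := h i hi
  rw [h1, h2, cutWeight]
  split_ifs at this ⊢ with he
  · rw [this, stepWeight_self]; ring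
  · rw [stepWeight_of_gt p q r this]; ring

theorem wordWeight_insertTwice_of_lt (p q r : R) {N l : ℕ} {w : List ℕ} (hw : ∀ a ∈ w, a < N)
    (hl : l + 1 < w.length) (hasc : w.getD l 0 < w.getD (l + 1) 0) :
    wordWeight p q r (insertTwice N w (l + 1)) = p * q * wordWeight p q r w := by
  obtain ⟨K, h1, h2⟩ := exists_wordWeight_insertTwice_succ p q r hw (i := l) (by omega)
  rw [h1, h2, stepWeight_of_lt p q r hasc]
  ring

theorem getD_insertTwice_zero_add_two (N : ℕ) (w : List ℕ) (i : ℕ) :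
    (insertTwice N w 0).getD (i + 2) 0 = w.getD i 0 := by
  simp [insertTwice]

theorem getD_insertTwice_of_lt (N : ℕ) {w : List ℕ} {i j : ℕ} (hj : j < i) (hi : i ≤ w.length) :
    (insertTwice N w i).getD j 0 = w.getD j 0 := by
  rw [insertTwice, List.getD_append _ _ _ _ (by rw [List.length_take]; omega),
    List.getD_eq_getElem _ _ (by rw [List.length_take]; omega),
    List.getD_eq_getElem _ _ (by omega), List.getElem_take]

theorem getD_insertTwice_self (N : ℕ) {w : List ℕ} {i : ℕ} (hi : i ≤ w.length) :
    (insertTwice N w i).getD i 0 = N := by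
  rw [insertTwice, List.getD_append_right _ _ _ _ (by rw [List.length_take]; omega)]
  simp [hi]

theorem length_insertTwice (N : ℕ) (w : List ℕ) (i : ℕ) :
    (insertTwice N w i).length = w.length + 2 := by
  simp only [insertTwice, List.length_append, List.length_cons, List.length_take, List.length_drop]
  omega

theorem mem_insertTwice {N a : ℕ} {w : List ℕ} {i : ℕ} :
    a ∈ insertTwice N w i ↔ a = N ∨ a ∈ w := by
  conv_rhs => rw [← List.take_append_drop i w]
  simp only [insertTwice, List.mem_append, List.mem_cons]
  tauto

theorem AlternatesUpTo.insertTwice_zero {N l : ℕ} {w : List ℕ} (h : AlternatesUpTo l w)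
    (hN : 0 < N) (hw : ∀ a ∈ w, a < N) : AlternatesUpTo (l + 2) (insertTwice N w 0) := by
  intro i hi
  rcases i with _ | _ | i
  · simp [insertTwice]
  · have := getD_lt_of_forall_mem_lt hN hw 0
    simpa [getD_insertTwice_zero_add_two N w 0, insertTwice] using this
  · rw [getD_insertTwice_zero_add_two, show i + 1 + 1 + 1 = i + 1 + 2 by rfl,
      getD_insertTwice_zero_add_two]
    simpa [Nat.even_add_one] using h i (by omega)

theorem AlternatesUpTo.insertTwice_succ {N l : ℕ} {w : List ℕ} (h : AlternatesUpTo l w)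
    {i : ℕ} (hi : i ≤ l) (hlen : i < w.length) :
    AlternatesUpTo i (insertTwice N w (i + 1)) := by
  intro j hj
  rw [getD_insertTwice_of_lt N (by omega) (by omega),
    getD_insertTwice_of_lt N (by omega) (by omega)]
  exact h j (by omega)

theorem descendantSum_eq_ascState (p q r : R) (m n l : ℕ) (w : List ℕ) (hw : ∀ a ∈ w, a ≤ n)
    (h : AlternatesUpTo l w) (hl : l + 1 < w.length) (hasc : w.getD l 0 < w.getD (l + 1) 0) :
    descendantSum p q r m n w = wordWeight p q r w * ascState p q r m l := by
  induction m generalizing n l w with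
  | zero => simp [descendantSum, ascState]
  | succ m ih =>
    have hw' : ∀ a ∈ w, a < n + 1 := fun a ha => Nat.lt_succ_of_le (hw a ha)
    have hmem : ∀ i, ∀ a ∈ insertTwice (n + 1) w i, a ≤ n + 1 := by
      intro i a ha
      rcases mem_insertTwice.1 ha with rfl | ha
      · exact le_rfl
      · exact (hw' a ha).le
    have hsucc : ∀ i ≤ l, descendantSum p q r m (n + 1) (insertTwice (n + 1) w (i + 1)) =
        wordWeight p q r (insertTwice (n + 1) w (i + 1)) * ascState p q r m i := by
      intro i hi
      refine ih _ _ _ (hmem _) (h.insertTwice_succ hi (by omega)) ?_ ?_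
      · rw [length_insertTwice]; omega
      · rw [getD_insertTwice_of_lt _ (by omega) (by omega), getD_insertTwice_self _ (by omega)]
        exact getD_lt_of_forall_mem_lt (Nat.succ_pos n) hw' i
    have hzero : descendantSum p q r m (n + 1) (insertTwice (n + 1) w 0) =
        wordWeight p q r (insertTwice (n + 1) w 0) * ascState p q r m (l + 2) := by
      refine ih _ _ _ (hmem _) (h.insertTwice_zero (Nat.succ_pos n) hw') ?_ ?_
      · rw [length_insertTwice]; omega
      · rw [getD_insertTwice_zero_add_two, show l + 2 + 1 = l + 1 + 2 by rfl,
          getD_insertTwice_zero_add_two]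
        exact hasc
    rw [descendantSum, h.insertionSites_eq_range_of_lt hl hasc, Finset.sum_range_succ',
      Finset.sum_range_succ, hzero, hsucc l le_rfl,
      wordWeight_insertTwice_zero p q r (Nat.succ_pos n) hw',
      wordWeight_insertTwice_of_lt p q r hw' hl hasc, ascState, mul_add, mul_add,
      Finset.mul_sum, Finset.mul_sum]
    rw [Finset.sum_congr rfl (g := fun i => wordWeight p q r w *
      (r * (cutWeight p q i * ascState p q r m i)))]
    · ring
    · intro i hi
      rw [Finset.mem_range] at hi
      rw [hsucc i hi.le, h.wordWeight_insertTwice p q r hw' hi (by omega)]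
      ring

theorem descendantSum_eq_endState (p q r : R) (m n j : ℕ) (w : List ℕ) (hw : ∀ a ∈ w, a ≤ n)
    (hlen : w.length = 2 * j) (h : AlternatesUpTo w.length w) :
    descendantSum p q r m n w = wordWeight p q r w * endState p q r m j := by
  induction m generalizing n j w with
  | zero => simp [descendantSum, endState]
  | succ m ih =>
    have hw' : ∀ a ∈ w, a < n + 1 := fun a ha => Nat.lt_succ_of_le (hw a ha)
    have hmem : ∀ i, ∀ a ∈ insertTwice (n + 1) w i, a ≤ n + 1 := by
      intro i a ha
      rcases mem_insertTwice.1 ha with rfl | ha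
      · exact le_rfl
      · exact (hw' a ha).le
    have hzero : descendantSum p q r m (n + 1) (insertTwice (n + 1) w 0) =
        wordWeight p q r (insertTwice (n + 1) w 0) * endState p q r m (j + 1) := by
      refine ih _ _ _ (hmem _) ?_ ?_
      · rw [length_insertTwice]; omega
      · rw [length_insertTwice]
        exact h.insertTwice_zero (Nat.succ_pos n) hw'
    rw [descendantSum, h.insertionSites_eq_range, Finset.sum_range_succ', hzero,
      wordWeight_insertTwice_zero p q r (Nat.succ_pos n) hw', endState, mul_add, ← hlen,
      Finset.mul_sum, Finset.mul_sum]
    rw [Finset.sum_congr rfl (g := fun i => wordWeight p q r w *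
      (r * (cutWeight p q i * ascState p q r m i)))]
    · ring
    · intro i hi
      rw [Finset.mem_range] at hi
      rw [descendantSum_eq_ascState p q r m (n + 1) i _ (hmem _) (h.insertTwice_succ hi.le hi),
        h.wordWeight_insertTwice p q r hw' hi hi]
      · ring
      · rw [length_insertTwice]; omega
      · rw [getD_insertTwice_of_lt _ (by omega) (by omega), getD_insertTwice_self _ (by omega)]
        exact getD_lt_of_forall_mem_lt (Nat.succ_pos n) hw' i

end Words

/-! ### Generating the avoiding Stirling permutations by insertion -/

section Insertion

theorem doubledMultiset_succ (n : ℕ) :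
    doubledMultiset (n + 1) = (n + 1) ::ₘ (n + 1) ::ₘ doubledMultiset n := by
  have : (Finset.Icc 1 (n + 1)).val = (n + 1) ::ₘ (Finset.Icc 1 n).val := by
    rw [← Finset.insert_Icc_right_eq_Icc_add_one (by omega), Finset.insert_val_of_notMem (by simp)]
  simp [doubledMultiset, this, two_nsmul]

theorem mem_doubledMultiset {n a : ℕ} : a ∈ doubledMultiset n ↔ 1 ≤ a ∧ a ≤ n := by
  rw [doubledMultiset, Multiset.mem_nsmul_of_ne_zero two_ne_zero, Finset.mem_val, Finset.mem_Icc]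

theorem IsStirlingPerm.mem_iff {n : ℕ} {w : List ℕ} (hw : IsStirlingPerm n w) {a : ℕ} :
    a ∈ w ↔ 1 ≤ a ∧ a ≤ n := by
  rw [← mem_doubledMultiset, ← hw.1, Multiset.mem_coe]

theorem containsPattern_iff (w : List ℕ) :
    ContainsPattern [1, 2, 3] w ↔ ∃ a b c, a < b ∧ b < c ∧ [a, b, c].Sublist w := by
  constructor
  · rintro ⟨s, hs, h, H⟩
    obtain ⟨a, b, c, rfl⟩ := List.length_eq_three.1 h
    exact ⟨a, b, c, (H 0 1).1 (by simp), (H 1 2).1 (by simp), hs⟩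
  · rintro ⟨a, b, c, hab, hbc, hs⟩
    refine ⟨_, hs, rfl, fun i j => ?_⟩
    fin_cases i <;> fin_cases j <;> simp <;> omega

theorem mem_avoidingStirlingPerms_iff (n : ℕ) (w : List ℕ) :
    w ∈ avoidingStirlingPerms n [1, 2, 3] ↔
      IsStirlingPerm n w ∧ ∀ a b c, a < b → b < c → ¬ [a, b, c].Sublist w := by
  rw [mem_avoidingStirlingPerms, containsPattern_iff]
  push Not
  rfl

theorem cons_sublist_of_cons_sublist_append {N : ℕ} {l x y : List ℕ} (hx : N ∉ x)
    (h : (N :: l).Sublist (x ++ y)) : (N :: l).Sublist y := by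
  induction x with
  | nil => exact h
  | cons c x ih =>
    rw [List.mem_cons, not_or] at hx
    rw [List.cons_append, List.cons_sublist_cons'] at h
    exact ih hx.2 (h.resolve_right fun h => hx.1 h.1)

theorem filter_insertTwice {N : ℕ} {w : List ℕ} (hN : N ∉ w) (i : ℕ) :
    (insertTwice N w i).filter (· ≠ N) = w := by
  have : w.filter (· ≠ N) = w :=
    List.filter_eq_self.2 fun a ha => by simpa using fun h : a = N => hN (h ▸ ha)
  conv_rhs => rw [← this, ← List.take_append_drop i w, List.filter_append]
  simp [insertTwice]

theorem sublist_of_sublist_insertTwice {N : ℕ} {w : List ℕ} (hN : N ∉ w) {i : ℕ} {l : List ℕ}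
    (hl : N ∉ l) (h : l.Sublist (insertTwice N w i)) : l.Sublist w := by
  have := h.filter (· ≠ N)
  rwa [filter_insertTwice hN,
    List.filter_eq_self.2 fun a ha => by simpa using fun h : a = N => hl (h ▸ ha)] at this

theorem not_sublist_insertTwice {N b : ℕ} {w : List ℕ} (hN : N ∉ w) (i : ℕ) :
    ¬ [N, b, N].Sublist (insertTwice N w i) := by
  intro h
  have hd : N ∉ w.drop i := fun h => hN (List.mem_of_mem_drop h)
  have h := cons_sublist_of_cons_sublist_append (fun h => hN (List.mem_of_mem_take h)) h
  rw [List.cons_sublist_cons, List.cons_sublist_cons'] at h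
  rcases h with h | ⟨-, h⟩
  · exact hd (h.subset (by simp))
  · exact hd (h.subset (by simp))

theorem sublist_take_of_sublist_insertTwice {N a b : ℕ} {w : List ℕ} (hN : N ∉ w) {i : ℕ}
    (hb : b ≠ N) (h : [a, b, N].Sublist (insertTwice N w i)) : [a, b].Sublist (w.take i) := by
  rw [← List.reverse_sublist] at h ⊢
  have e : (insertTwice N w i).reverse = (w.drop i).reverse ++ N :: N :: (w.take i).reverse := by
    simp [insertTwice]
  rw [e] at h
  have h := cons_sublist_of_cons_sublist_append
    (fun h => hN (List.mem_of_mem_drop (List.mem_reverse.1 h))) h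
  rw [List.cons_sublist_cons, List.cons_sublist_cons'] at h
  exact h.resolve_right fun h => hb h.1

theorem coe_insertTwice (N : ℕ) (w : List ℕ) (i : ℕ) :
    (insertTwice N w i : Multiset ℕ) = N ::ₘ N ::ₘ (w : Multiset ℕ) := by
  conv_rhs => rw [← List.take_append_drop i w]
  simp only [Multiset.cons_coe, Multiset.coe_eq_coe, insertTwice]
  exact List.perm_middle.trans (List.perm_middle.cons N)

theorem insertTwice_mem_avoidingStirlingPerms {n : ℕ} {w : List ℕ}
    (hw : w ∈ avoidingStirlingPerms n [1, 2, 3]) {i : ℕ} (hi : i ∈ insertionSites w) :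
    insertTwice (n + 1) w i ∈ avoidingStirlingPerms (n + 1) [1, 2, 3] := by
  rw [mem_avoidingStirlingPerms_iff] at hw ⊢
  obtain ⟨hS, hA⟩ := hw
  have hN : n + 1 ∉ w := fun h => by have := (hS.mem_iff.1 h).2; omega
  have hle : ∀ {l a}, List.Sublist l (insertTwice (n + 1) w i) → a ∈ l → a ≤ n + 1 := by
    intro l a h ha
    rcases mem_insertTwice.1 (h.subset ha) with h | h
    · exact h.le
    · exact (hS.mem_iff.1 h).2.trans n.le_succ
  refine ⟨⟨?_, fun a b h => ?_⟩, fun a b c hab hbc h => ?_⟩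
  · rw [coe_insertTwice, hS.1, doubledMultiset_succ]
  · have ha := hle h (a := a) (by simp)
    have hb := hle h (a := b) (by simp)
    have haN : a ≠ n + 1 := by
      rintro rfl
      exact not_sublist_insertTwice hN i h
    by_cases hbN : b = n + 1
    · omega
    · exact hS.2 a b (sublist_of_sublist_insertTwice hN (by simp; omega) h)
  · have hc := hle h (a := c) (by simp)
    by_cases hcN : c = n + 1
    · subst hcN
      have := sublist_take_of_sublist_insertTwice hN hbc.ne h
      have := List.pairwise_iff_forall_sublist.1 (Finset.mem_filter.1 hi).2 this
      omega
    · exact hA a b c hab hbc (sublist_of_sublist_insertTwice hN (by simp; omega) h)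

/-- The two copies of the largest letter are adjacent, since a letter between them would have to be
larger; an ascent to the left of them would complete a `123`. -/
theorem exists_insertTwice_eq {n : ℕ} {w : List ℕ}
    (hw : w ∈ avoidingStirlingPerms (n + 1) [1, 2, 3]) :
    ∃ v ∈ avoidingStirlingPerms n [1, 2, 3], ∃ i ∈ insertionSites v,
      insertTwice (n + 1) v i = w := by
  rw [mem_avoidingStirlingPerms_iff] at hw
  obtain ⟨hS, hA⟩ := hw
  obtain ⟨x, t, rfl, hx⟩ := List.eq_append_cons_of_mem (hS.mem_iff.2 ⟨by omega, le_refl (n + 1)⟩)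
  have ht : n + 1 ∈ t := by
    have := congrArg (Multiset.count (n + 1)) hS.1
    rw [doubledMultiset_succ] at this
    simp only [Multiset.coe_count, List.count_append, List.count_cons_self,
      List.count_eq_zero_of_not_mem hx, Multiset.count_cons_self] at this
    exact List.count_pos_iff.1 (by omega)
  obtain ⟨y, z, rfl⟩ := List.append_of_mem ht
  obtain rfl : y = [] := by
    rcases y with _ | ⟨b, y⟩
    · rfl
    · have h1 := hS.2 (n + 1) b (List.sublist_append_of_sublist_right (by simp))
      have h2 := (hS.mem_iff (a := b)).1 (by simp)
      omega
  have e : insertTwice (n + 1) (x ++ z) x.length = x ++ (n + 1) :: ([] ++ (n + 1) :: z) := by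
    simp [insertTwice]
  have hsub : (x ++ z).Sublist (x ++ (n + 1) :: ([] ++ (n + 1) :: z)) := by simp
  refine ⟨x ++ z, ?_, x.length, ?_, e⟩
  · rw [mem_avoidingStirlingPerms_iff]
    refine ⟨⟨?_, fun a b h => hS.2 a b (h.trans hsub)⟩,
      fun a b c hab hbc h => hA a b c hab hbc (h.trans hsub)⟩
    have := hS.1
    rw [← e, coe_insertTwice, doubledMultiset_succ] at this
    exact (Multiset.cons_inj_right _).1 ((Multiset.cons_inj_right _).1 this)
  · rw [insertionSites, Finset.mem_filter, Finset.mem_range, List.take_left]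
    refine ⟨by simp, List.pairwise_iff_forall_sublist.2 fun {a b} h => ?_⟩
    by_contra hab
    have hbx : b ∈ x := h.subset (by simp)
    have hb := (hS.mem_iff (a := b)).1 (by simp [hbx])
    have hbN : b ≠ n + 1 := fun h => hx (h ▸ hbx)
    refine hA a b (n + 1) (by omega) (by omega) ?_
    exact List.Sublist.append (l₁ := [a, b]) (r₁ := [n + 1]) h (by simp)

theorem insertTwice_injective {N : ℕ} {v w : List ℕ} {i j : ℕ} (hv : N ∉ v) (hw : N ∉ w)
    (hi : i ≤ v.length) (hj : j ≤ w.length) (h : insertTwice N v i = insertTwice N w j) :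
    v = w ∧ i = j := by
  have hvw : v = w := by rw [← filter_insertTwice hv i, h, filter_insertTwice hw j]
  refine ⟨hvw, ?_⟩
  have idx : ∀ {u : List ℕ} {k}, N ∉ u → k ≤ u.length → (insertTwice N u k).idxOf N = k := by
    intro u k hu hk
    rw [insertTwice, List.idxOf_append_of_notMem fun h => hu (List.mem_of_mem_take h)]
    simp [hk]
  rw [← idx hv hi, h, idx hw hj]

/-- Inserting the doubled letter `n + 1` at an insertion site is a bijection onto the avoiding Stirling
permutations of order `n + 1`. -/
theorem sum_avoidingStirlingPerms_succ {M : Type*} [AddCommMonoid M] (n : ℕ) (f : List ℕ → M) :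
    ∑ w ∈ avoidingStirlingPerms (n + 1) [1, 2, 3], f w =
      ∑ w ∈ avoidingStirlingPerms n [1, 2, 3], ∑ i ∈ insertionSites w,
        f (insertTwice (n + 1) w i) := by
  rw [Finset.sum_sigma']
  symm
  refine Finset.sum_bij (fun x _ => insertTwice (n + 1) x.1 x.2) ?_ ?_ ?_ fun _ _ => rfl
  · rintro ⟨w, i⟩ h
    rw [Finset.mem_sigma] at h
    exact insertTwice_mem_avoidingStirlingPerms h.1 h.2
  · rintro ⟨v, i⟩ hv ⟨w, j⟩ hw h
    rw [Finset.mem_sigma] at hv hw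
    have notMem : ∀ {u}, u ∈ avoidingStirlingPerms n [1, 2, 3] → n + 1 ∉ u := fun hu h => by
      have := (((mem_avoidingStirlingPerms_iff _ _).1 hu).1.mem_iff.1 h).2
      omega
    have le_length : ∀ {u k}, k ∈ insertionSites u → k ≤ u.length := fun hk =>
      Nat.lt_succ_iff.1 (Finset.mem_range.1 (Finset.mem_filter.1 hk).1)
    obtain ⟨rfl, rfl⟩ := insertTwice_injective (notMem hv.1) (notMem hw.1) (le_length hv.2)
      (le_length hw.2) h
    rfl
  · intro w hw
    obtain ⟨v, hv, i, hi, h⟩ := exists_insertTwice_eq hw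
    exact ⟨⟨v, i⟩, Finset.mem_sigma.2 ⟨hv, hi⟩, h⟩

theorem avoidingStirlingPerms_zero : avoidingStirlingPerms 0 [1, 2, 3] = {[]} := by
  ext w
  rw [mem_avoidingStirlingPerms_iff, Finset.mem_singleton]
  constructor
  · intro h
    have := h.1.1
    simpa [doubledMultiset] using this
  · rintro rfl
    exact ⟨⟨by simp [doubledMultiset], by simp⟩, by simp⟩

variable {R : Type*} [CommRing R]

theorem sum_descendantSum (p q r : R) (m n : ℕ) :
    ∑ w ∈ avoidingStirlingPerms n [1, 2, 3], descendantSum p q r m n w =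
      ∑ w ∈ avoidingStirlingPerms (n + m) [1, 2, 3], wordWeight p q r w := by
  induction m generalizing n with
  | zero => rfl
  | succ m ih =>
    simp only [descendantSum]
    rw [← sum_avoidingStirlingPerms_succ n, ih, Nat.add_right_comm, Nat.add_assoc]

theorem sum_wordWeight (p q r : R) (n : ℕ) :
    ∑ w ∈ avoidingStirlingPerms n [1, 2, 3], wordWeight p q r w = endState p q r n 0 := by
  have := sum_descendantSum p q r n 0
  rw [zero_add, avoidingStirlingPerms_zero, Finset.sum_singleton,
    descendantSum_eq_endState p q r n 0 0 [] (by simp) rfl (by simp [AlternatesUpTo])] at this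
  rw [← this, wordWeight, one_mul]

/-- The sentinel contributes the extra factor `q`; it needs a nonempty word with positive letters. -/
theorem wordWeight_eq (p q r : R) {w : List ℕ} (hw : w ≠ []) (hpos : ∀ a ∈ w, 0 < a) :
    wordWeight p q r w = q * (p ^ plat w * q ^ des w * r ^ asc w) := by
  induction w with
  | nil => exact absurd rfl hw
  | cons a l ih =>
    rcases l with _ | ⟨b, l⟩
    · simp [wordWeight, stepWeight_of_gt p q r (hpos a (by simp)), plat, des, asc]
    · have ih := ih (by simp) fun c hc => hpos c (List.mem_cons_of_mem _ hc)
      rw [wordWeight, ih]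
      simp only [plat, des, asc, List.tail_cons, List.zip_cons_cons, List.countP_cons,
        List.headD_cons]
      rcases lt_trichotomy a b with h | rfl | h
      · simp [stepWeight_of_lt p q r h, h, h.ne, h.not_gt]
        ring
      · simp [stepWeight_self]
        ring
      · simp [stepWeight_of_gt p q r h, h, h.ne', h.not_gt]
        ring

theorem sum_plat_des_asc (p q r : R) {n : ℕ} (hn : 1 ≤ n) :
    q * ∑ w ∈ avoidingStirlingPerms n [1, 2, 3], p ^ plat w * q ^ des w * r ^ asc w =
      endState p q r n 0 := by
  rw [← sum_wordWeight, Finset.mul_sum]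
  refine Finset.sum_congr rfl fun w hw => ?_
  have hS := ((mem_avoidingStirlingPerms_iff _ _).1 hw).1
  refine (wordWeight_eq p q r ?_ fun a ha => (hS.mem_iff.1 ha).1).symm
  rintro rfl
  simpa using hS.mem_iff.2 ⟨le_rfl, hn⟩

end Insertion

/-! ### Symmetry and the plateau distribution -/

theorem map_ascState {R S : Type*} [CommRing R] [CommRing S] (f : R →+* S) (p q r : R) (m l : ℕ) :
    f (ascState p q r m l) = ascState (f p) (f q) (f r) m l := by
  induction m generalizing l with
  | zero => simp [ascState]
  | succ m ih => simp [ascState, ih, cutWeight, apply_ite f]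

theorem map_endState {R S : Type*} [CommRing R] [CommRing S] (f : R →+* S) (p q r : R) (m j : ℕ) :
    f (endState p q r m j) = endState (f p) (f q) (f r) m j := by
  induction m generalizing j with
  | zero => simp [endState]
  | succ m ih => simp [endState, ih, cutWeight, apply_ite f, map_ascState]

theorem theorem2 (n : ℕ) (hn : 1 ≤ n) :
    MvPolynomial.rename (Equiv.swap (0 : Fin 3) 1)
        (MvPolynomial.X 1 * stirlingPoly n [1, 2, 3]) =
      MvPolynomial.X 1 * stirlingPoly n [1, 2, 3] ∧
    (∑ σ ∈ avoidingStirlingPerms n [1, 2, 3], (Polynomial.X : Polynomial ℚ) ^ plat σ) =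
      Polynomial.C (1 / ((n : ℚ) + 1)) *
        ∑ j ∈ Finset.range (n + 1),
          Polynomial.C (((n + 1).choose j : ℚ) * ((2 * n - j).choose (n + j) : ℚ)) *
            Polynomial.X ^ (n - j) := by
  constructor
  · have h := map_endState (MvPolynomial.rename (R := ℚ) (Equiv.swap (0 : Fin 3) 1)).toRingHom
      (MvPolynomial.X 0) (MvPolynomial.X 1) (MvPolynomial.X 2) n 0
    rw [stirlingPoly, sum_plat_des_asc _ _ _ hn]
    have h2 : Equiv.swap (0 : Fin 3) 1 2 = 2 := by decide
    refine Eq.trans ?_ (endState_zero_swap _ _ _ n)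
    simpa [MvPolynomial.rename_X, h2] using h
  · have h1 := sum_plat_des_asc (Polynomial.X : Polynomial ℚ) 1 1 hn
    have h2 := succ_mul_endState_one_one (Polynomial.X_ne_zero (R := ℚ)) n
    simp only [one_mul, one_pow, mul_one] at h1
    have hn1 : (n : ℚ) + 1 ≠ 0 := by positivity
    have hC : Polynomial.C (1 / ((n : ℚ) + 1)) * ((n + 1 : ℕ) : Polynomial ℚ) = 1 := by
      rw [← map_natCast (Polynomial.C : ℚ →+* Polynomial ℚ), ← map_mul]
      push_cast
      rw [one_div_mul_cancel hn1, map_one]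
    simp only [map_mul, map_natCast]
    rw [← h2, ← mul_assoc, hC, one_mul, h1]
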